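/- Notation: $[n]=\{1,\dots,n\}$. A set system $\mathcal{F}\subseteq 2^{[n]}$ *shatters* $S\subseteq[n]$ if $\{F\cap S : F\in\mathcal{F}\}=2^{S}$; its *VC-dimension* is the maximum cardinality of a set it shatters; it is *s-extremal* (shattering-extremal) if it shatters exactly $|\mathcal{F}|$ sets. The projection of $\mathcal{F}$ to $X\subseteq[n]$ is $\mathcal{F}|_X=\{F\cap X : F\in\mathcal{F}\}$. Theorem. Let $t\ge 1$ and $n\ge 2t+1$ be integers, and let $\mathcal{F}\subseteq 2^{[n]}$ be a family of VC-dimension $t$ such that $\mathcal{F}|_X$ is s-extremal for every $X\subseteq[n]$ with $|X|=2t+1$. Let $$\mathcal{G}=\{H\subseteq[n] : H\cap X\in\mathcal{F}|_X \text{ for all } X\subseteq[n] \text{ with } |X|=2t+1\}.$$ Then $\mathcal{F}\subseteq\mathcal{G}$, $\mathcal{G}$ is s-extremal, and $\mathcal{G}$ has VC-dimension $t$. Moreover, if $\mathcal{F}$ is s-extremal, then $\mathcal{G}=\mathcal{F}$. -/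

import Mathlib

namespace SExtremal

/-- A set system is *shattering-extremal* if it shatters exactly as many sets as it has members. -/
def IsSExtremal {α : Type*} [DecidableEq α] (F : Finset (Finset α)) : Prop :=
  F.shatterer.card = F.card

/-- The projection `F|_X = {A ∩ X : A ∈ F}` of a set system `F` to a set `X`. -/
def proj {α : Type*} [DecidableEq α] (F : Finset (Finset α)) (X : Finset α) :
    Finset (Finset α) :=
  F.image (fun A => A ∩ X)

/-- The family of all `H ⊆ [n]` with `H ∩ X ∈ F|_X` for every `k`-element set `X ⊆ [n]`. -/
def closureByProj {n : ℕ} (F : Finset (Finset (Fin n))) (k : ℕ) : Finset (Finset (Fin n)) :=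
  Finset.univ.filter (fun H => ∀ X : Finset (Fin n), X.card = k → H ∩ X ∈ proj F X)

end SExtremal

namespace SExtremal

open Finset

/-! ### Strong shattering by subcubes. -/

section StrongShattering

variable {α : Type*} {F F' : Finset (Finset α)} {S T : Finset α}

/-! A family is s-extremal iff every set it shatters is the direction set of a cube inside it
(`isSExtremal_iff`). With `k = 2t+1`, it suffices that `F` and its local hull shatter the same sets
and that the hull contains a cube for each of them. The first is a test on `k`-subsets, as `k > t`.

The cubes come by induction on the coordinate set `Y` (`hullHasCubes_of_erase`). If `|Y| ≤ k`, the
extremal projections supply them. Otherwise take a maximal shattered `S ⊆ Y`. The `S`-cubes in the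
hulls on `Y.erase j`, for `j ∈ Y \ S`, agree off `S` (`agree_of_maximal`) and glue to one cube. If a
vertex of it failed the hull on `Y.erase i` with `i ∈ S`, all its neighbours in directions `Y \ S`
would lie in that hull, which would then shatter all but one element of `Y \ S` (`shatters_erase`).
These are at least `(2t+2) - t - 1 = t+1` elements, a contradiction. -/

/-- A family strongly shatters `S` if it contains a subcube with direction set `S`. -/
def StronglyShatters (F : Finset (Finset α)) (S : Finset α) : Prop :=
  ∃ A : Finset α, ∀ B : Finset α, (∀ x, x ∉ S → (x ∈ B ↔ x ∈ A)) → B ∈ F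

lemma StronglyShatters.mono_left (h : F ⊆ F') (hS : StronglyShatters F S) :
    StronglyShatters F' S :=
  let ⟨A, hA⟩ := hS; ⟨A, fun B hB => h (hA B hB)⟩

lemma StronglyShatters.mono_right (h : T ⊆ S) (hS : StronglyShatters F S) :
    StronglyShatters F T :=
  let ⟨A, hA⟩ := hS; ⟨A, fun B hB => hA B fun x hx => hB x fun hxT => hx (h hxT)⟩

end StrongShattering

/-! ### S-extremal families: cubes, complements, slices and neighbours. -/

section Shattering

variable {α : Type*} [DecidableEq α] {F F' : Finset (Finset α)} {S : Finset α}

lemma shatters_iff_forall_exists_agree :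
    F.Shatters S ↔ ∀ A : Finset α, ∃ B ∈ F, ∀ x ∈ S, (x ∈ B ↔ x ∈ A) := by
  constructor
  · intro h A
    obtain ⟨B, hB, hBA⟩ := h (inter_subset_left (s₁ := S) (s₂ := A))
    refine ⟨B, hB, fun x hx => ?_⟩
    have := congrArg (x ∈ ·) hBA
    simpa [hx] using this
  · intro h T hT
    obtain ⟨B, hB, hBT⟩ := h T
    refine ⟨B, hB, ?_⟩
    ext x
    grind

/-- A shattering-extremal family strongly shatters every set it shatters. -/
lemma IsSExtremal.stronglyShatters (hF : IsSExtremal F) (hS : F.Shatters S) :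
    StronglyShatters F S := by
  induction S using Finset.induction_on generalizing F with
  | empty =>
    obtain ⟨A, hA⟩ := hS.nonempty
    refine ⟨A, fun B hB => ?_⟩
    have : B = A := by ext x; exact hB x (by simp)
    rwa [this]
  | insert a S ha ih =>
    set M := F.memberSubfamily a
    set N := F.nonMemberSubfamily a
    have hnot {K : Finset (Finset α)} (hK : ∀ A ∈ K, a ∉ A) {R : Finset α}
        (hR : K.Shatters R) : a ∉ R := by
      obtain ⟨A, hA, hRA⟩ := hR.exists_superset
      exact fun h => hK A hA (hRA h)
    have hM : ∀ A ∈ M, a ∉ A := fun A hA => (mem_memberSubfamily.1 hA).2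
    have hN : ∀ A ∈ N, a ∉ A := fun A hA => (mem_nonMemberSubfamily.1 hA).2
    have hI : ∀ A ∈ M ∩ N, a ∉ A := fun A hA => hM A (mem_of_mem_inter_left hA)
    have hU : ∀ A ∈ M ∪ N, a ∉ A := fun A hA => (mem_union.1 hA).elim (hM A) (hN A)
    have hsub : (M ∪ N).shatterer ∪ (M ∩ N).shatterer.image (insert a) ⊆ F.shatterer := by
      intro R hR
      rw [mem_shatterer, shatters_iff_forall_exists_agree]
      intro A
      replace hR := mem_union.1 hR
      rcases hR with hR | hR
      · rw [mem_shatterer] at hR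
        have haR := hnot hU hR
        obtain ⟨B, hB, hBA⟩ := shatters_iff_forall_exists_agree.1 hR A
        rcases mem_union.1 hB with hB | hB
        · exact ⟨insert a B, (mem_memberSubfamily.1 hB).1, by grind⟩
        · exact ⟨B, (mem_nonMemberSubfamily.1 hB).1, hBA⟩
      · obtain ⟨Q, hQ, rfl⟩ := mem_image.1 hR
        rw [mem_shatterer] at hQ
        obtain ⟨B, hB, hBA⟩ := shatters_iff_forall_exists_agree.1 hQ A
        obtain ⟨hB1, hB2⟩ := mem_inter.1 hB
        rw [mem_memberSubfamily] at hB1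
        rw [mem_nonMemberSubfamily] at hB2
        by_cases haA : a ∈ A
        · exact ⟨insert a B, hB1.1, by grind⟩
        · exact ⟨B, hB2.1, by grind⟩
    have hdisj : Disjoint (M ∪ N).shatterer ((M ∩ N).shatterer.image (insert a)) := by
      rw [disjoint_left]
      intro R hR hR'
      obtain ⟨R', -, rfl⟩ := mem_image.1 hR'
      exact hnot hU (mem_shatterer.1 hR) (mem_insert_self a R')
    have hinj : ((M ∩ N).shatterer.image (insert a)).card = (M ∩ N).shatterer.card := by
      refine card_image_of_injOn fun R hR R' hR' h => ?_
      have h1 := hnot hI (mem_shatterer.1 hR)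
      have h2 := hnot hI (mem_shatterer.1 hR')
      rw [← erase_insert h1, ← erase_insert h2]
      exact congrArg (fun Q => Q.erase a) h
    have h1 := card_le_card_shatterer (M ∪ N)
    have h2 := card_le_card_shatterer (M ∩ N)
    have h3 : M.card + N.card = F.card := card_memberSubfamily_add_card_nonMemberSubfamily a F
    have h4 := card_union_add_card_inter M N
    have h5 := card_le_card hsub
    have h6 := card_union_of_disjoint hdisj
    unfold IsSExtremal at hF
    -- Both `M ∪ N` and `M ∩ N` shatter at least as many sets as they have members, and these sizes
    -- sum to `|F|`, so extremality of `F` forces equality throughout.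
    have hext : IsSExtremal (M ∩ N) := by unfold IsSExtremal; omega
    have heq : (M ∪ N).shatterer ∪ (M ∩ N).shatterer.image (insert a) = F.shatterer :=
      eq_of_subset_of_card_le hsub (by omega)
    have hS' : (M ∩ N).Shatters S := by
      have := mem_shatterer.2 hS
      rw [← heq, mem_union] at this
      rcases this with h | h
      · exact absurd (mem_insert_self a S) (hnot hU (mem_shatterer.1 h))
      · obtain ⟨R, hR, hRS⟩ := mem_image.1 h
        have haR := hnot hI (mem_shatterer.1 hR)
        have : R = S := by
          rw [← erase_insert haR, ← erase_insert ha, hRS]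
        rw [← this]
        exact mem_shatterer.1 hR
    obtain ⟨A, hA⟩ := ih hext hS'
    have hAn := hI A (hA A fun _ _ => Iff.rfl)
    refine ⟨A, fun B hB => ?_⟩
    have hmem := mem_inter.1 (hA (B.erase a) (by grind))
    by_cases haB : a ∈ B
    · have := (mem_memberSubfamily.1 hmem.1).1
      rwa [insert_erase haB] at this
    · have := (mem_nonMemberSubfamily.1 hmem.2).1
      rwa [erase_eq_of_notMem haB] at this

lemma mem_proj_iff {H X : Finset α} :
    H ∈ proj F X ↔ H ⊆ X ∧ ∃ B ∈ F, ∀ x ∈ X, (x ∈ B ↔ x ∈ H) := by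
  simp only [proj, mem_image]
  constructor
  · rintro ⟨B, hB, rfl⟩
    exact ⟨inter_subset_right, B, hB, by grind⟩
  · rintro ⟨hH, B, hB, hBH⟩
    exact ⟨B, hB, by grind⟩

variable [Fintype α]

/-- A pattern on `S` missed by `F` is exactly a cube with directions `Sᶜ` avoiding `F`. -/
lemma stronglyShatters_compl_iff : StronglyShatters Fᶜ Sᶜ ↔ ¬ F.Shatters S := by
  rw [shatters_iff_forall_exists_agree, StronglyShatters]
  push Not
  refine exists_congr fun A => forall_congr' fun B => ?_
  simp only [mem_compl, not_not]
  grind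

/-- By duality, complements of sets shattered by `F'ᶜ` are not shattered by `F`; there are at least
`|F'ᶜ|` of them. -/
lemma card_shatterer_le_of_stronglyShatters
    (h : ∀ S, F.Shatters S → StronglyShatters F' S) : F.shatterer.card ≤ F'.card := by
  have h1 : F'ᶜ.shatterer.image compl ⊆ F.shattererᶜ := by
    intro R hR
    obtain ⟨S, hS, rfl⟩ := mem_image.1 hR
    rw [mem_compl, mem_shatterer]
    intro hR
    have := h _ hR
    rw [← compl_compl F', stronglyShatters_compl_iff] at this
    exact this (mem_shatterer.1 hS)
  have h2 := card_le_card h1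
  rw [card_image_of_injective _ compl_injective, card_compl] at h2
  have h3 := card_le_card_shatterer F'ᶜ
  rw [card_compl] at h3
  have h5 := card_le_univ F.shatterer
  have h6 := card_le_univ F'
  omega

lemma isSExtremal_iff : IsSExtremal F ↔ ∀ S, F.Shatters S → StronglyShatters F S :=
  ⟨fun h _ => h.stronglyShatters, fun h =>
    le_antisymm (card_shatterer_le_of_stronglyShatters h) (card_le_card_shatterer F)⟩

lemma IsSExtremal.compl (hF : IsSExtremal F) : IsSExtremal Fᶜ := by
  rw [isSExtremal_iff]
  intro S hS
  rw [← compl_compl S, stronglyShatters_compl_iff]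
  intro h
  have := hF.stronglyShatters h
  rw [← compl_compl F, stronglyShatters_compl_iff] at this
  exact this hS

lemma IsSExtremal.filter_mem_iff (hF : IsSExtremal F) (a : α) (A : Finset α) :
    IsSExtremal (F.filter fun B => a ∈ B ↔ a ∈ A) := by
  rw [isSExtremal_iff]
  intro S hS
  have haS : a ∉ S := by
    intro haS
    obtain ⟨B, hB, hBA⟩ := shatters_iff_forall_exists_agree.1 hS (if a ∈ A then ∅ else {a})
    have := (mem_filter.1 hB).2
    have := hBA a haS
    split_ifs at this <;> simp_all
  by_cases hins : F.Shatters (insert a S)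
  · obtain ⟨C, hC⟩ := hF.stronglyShatters hins
    refine ⟨if a ∈ A then insert a C else C.erase a, fun B hB => mem_filter.2 ⟨hC B ?_, ?_⟩⟩
    · intro x hx
      rw [hB x (by grind)]
      split_ifs <;> grind
    · rw [hB a haS]
      split_ifs with h <;> simp [h]
  · obtain ⟨C, hC⟩ := hF.stronglyShatters (hS.mono_left (filter_subset _ _))
    refine ⟨C, fun B hB => mem_filter.2 ⟨hC B hB, ?_⟩⟩
    rw [hB a haS]
    -- A cube on the wrong side of `a`, together with the slice shattering `S`, would make `F`
    -- shatter `insert a S`.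
    by_contra hCA
    apply hins
    rw [shatters_iff_forall_exists_agree]
    intro D
    by_cases hD : a ∈ D ↔ a ∈ A
    · obtain ⟨E, hE, hED⟩ := shatters_iff_forall_exists_agree.1 hS D
      obtain ⟨hE1, hE2⟩ := mem_filter.1 hE
      exact ⟨E, hE1, by grind⟩
    · refine ⟨(C \ S) ∪ (D ∩ S), hC _ (by grind), by grind⟩

lemma IsSExtremal.filter_agree (hF : IsSExtremal F) (E A : Finset α) :
    IsSExtremal (F.filter fun B => ∀ x ∈ E, (x ∈ B ↔ x ∈ A)) := by
  induction E using Finset.induction_on with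
  | empty => simpa using hF
  | insert a E _ ih =>
    convert ih.filter_mem_iff a A using 1
    ext B
    simp only [mem_filter, mem_insert, forall_eq_or_imp]
    tauto

/-- Each member of a shattering-extremal family has a neighbour in the family towards any other
member. -/
lemma IsSExtremal.exists_symmDiff_singleton_mem (hF : IsSExtremal F) {A B : Finset α}
    (hA : A ∈ F) (hB : B ∈ F) (hAB : A ≠ B) : ∃ j ∈ symmDiff A B, symmDiff A {j} ∈ F := by
  induction hn : (symmDiff A B).card using Nat.strong_induction_on generalizing B with
  | _ n ih =>
    obtain ⟨a, ha⟩ : (symmDiff A B).Nonempty := by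
      rw [nonempty_iff_ne_empty]
      exact fun h => hAB (symmDiff_eq_bot.1 h)
    -- Restricting to the smallest cube containing `A` and `B` keeps the members found between them.
    have hK := hF.filter_agree (symmDiff A B)ᶜ A
    set K := F.filter fun C => ∀ x ∈ (symmDiff A B)ᶜ, (x ∈ C ↔ x ∈ A) with hKdef
    have hAK : A ∈ K := by simp [hKdef, hA]
    have hBK : B ∈ K := by
      refine mem_filter.2 ⟨hB, fun x hx => ?_⟩
      rw [mem_compl, mem_symmDiff] at hx
      tauto
    have hS : K.Shatters {a} := by
      rw [shatters_iff_forall_exists_agree]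
      intro C
      rw [mem_symmDiff] at ha
      by_cases h : a ∈ A ↔ a ∈ C
      · exact ⟨A, hAK, by simpa using h⟩
      · exact ⟨B, hBK, by simp only [mem_singleton, forall_eq]; tauto⟩
    obtain ⟨C, hC⟩ := hK.stronglyShatters hS
    obtain ⟨D, hD, hDC, haD⟩ : ∃ D, D ∈ K ∧ (∀ x, x ≠ a → (x ∈ D ↔ x ∈ C)) ∧
        (a ∈ D ↔ a ∈ A) := by
      by_cases haA : a ∈ A
      · exact ⟨insert a C, hC _ (by grind), by grind, by grind⟩
      · exact ⟨C.erase a, hC _ (by grind), by grind, by grind⟩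
    by_cases hDA : D = A
    · refine ⟨a, ha, (mem_filter.1 (hC _ fun x hx => ?_)).1⟩
      rw [← hDA, ← hDC x (by simpa using hx)]
      simp only [mem_symmDiff, mem_singleton] at hx ⊢
      tauto
    · have hsub : symmDiff A D ⊂ symmDiff A B := by
        rw [ssubset_iff_of_subset]
        · exact ⟨a, ha, by rw [mem_symmDiff]; tauto⟩
        · intro x hx
          by_contra h
          have := (mem_filter.1 hD).2 x (mem_compl.2 h)
          rw [mem_symmDiff] at hx
          tauto
      obtain ⟨j, hj, hjF⟩ := ih _ (hn ▸ card_lt_card hsub) (mem_filter.1 hD).1 (Ne.symm hDA) rfl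
      exact ⟨j, hsub.1 hj, hjF⟩

/-- If all neighbours of a non-member in the directions `J` are members, then so is the rest of
the cube spanned by these directions. -/
lemma IsSExtremal.shatters_erase (hF : IsSExtremal F) {H J : Finset α} (hH : H ∉ F)
    (hJ : ∀ j ∈ J, symmDiff H {j} ∈ F) {a : α} (ha : a ∈ J) : F.Shatters (J.erase a) := by
  have hcube (T : Finset α) (hT : T ⊆ J) (hTn : T.Nonempty) : symmDiff H T ∈ F := by
    by_contra h
    -- The complement is extremal too, so a second non-member in the cube would force a non-member
    -- next to `H`.
    obtain ⟨j, hj, hjF⟩ := hF.compl.exists_symmDiff_singleton_mem (mem_compl.2 hH)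
      (mem_compl.2 h) (fun h' => hTn.ne_empty (by simpa using h'.symm))
    rw [symmDiff_symmDiff_cancel_left] at hj
    exact mem_compl.1 hjF (hJ j (hT hj))
  rw [shatters_iff_forall_exists_agree]
  intro A
  -- Always flipping `a` avoids the missing vertex `H`; this costs the one direction `a`.
  refine ⟨symmDiff H (insert a (symmDiff H A ∩ J)), hcube _ (by grind) (by simp), fun x hx => ?_⟩
  simp only [mem_erase] at hx
  simp only [mem_symmDiff, mem_insert, mem_inter]
  tauto

end Shattering
-- Local hulls and the gluing of cubes.
section LocalHull

variable {α : Type*} [DecidableEq α] [Fintype α] {F : Finset (Finset α)} {k : ℕ}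
  {H H' S Y Z : Finset α}

/-- The sets that agree with some member of `F` on every subset of `Y` of size at most `k`. -/
def localHull (F : Finset (Finset α)) (k : ℕ) (Y : Finset α) : Finset (Finset α) :=
  univ.filter fun H => ∀ X ⊆ Y, X.card ≤ k → ∃ B ∈ F, ∀ x ∈ X, (x ∈ B ↔ x ∈ H)

lemma mem_localHull :
    H ∈ localHull F k Y ↔ ∀ X ⊆ Y, X.card ≤ k → ∃ B ∈ F, ∀ x ∈ X, (x ∈ B ↔ x ∈ H) := by
  simp [localHull]

lemma mem_localHull_of_agree (h : ∀ x ∈ Y, (x ∈ H ↔ x ∈ H')) (hH : H ∈ localHull F k Y) :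
    H' ∈ localHull F k Y := by
  rw [mem_localHull] at hH ⊢
  intro X hX hXk
  obtain ⟨B, hB, hBH⟩ := hH X hX hXk
  exact ⟨B, hB, fun x hx => (hBH x hx).trans (h x (hX hx))⟩

lemma localHull_anti (h : Z ⊆ Y) : localHull F k Y ⊆ localHull F k Z := by
  intro H hH
  rw [mem_localHull] at hH ⊢
  exact fun X hX => hH X (hX.trans h)

lemma subset_localHull : F ⊆ localHull F k Y :=
  fun H hH => mem_localHull.2 fun _ _ _ => ⟨H, hH, fun _ _ => Iff.rfl⟩

lemma mem_localHull_of_erase (hY : k < Y.card) (h : ∀ i ∈ Y, H ∈ localHull F k (Y.erase i)) :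
    H ∈ localHull F k Y := by
  rw [mem_localHull]
  intro X hX hXk
  obtain ⟨i, hi, hiX⟩ := exists_mem_notMem_of_card_lt_card (hXk.trans_lt hY)
  exact mem_localHull.1 (h i hi) X (subset_erase.2 ⟨hX, hiX⟩) hXk

/-- Patterns on at most `k` points are inherited from `F`; a larger `S` would contain a `k`-set
shattered by `F`, exceeding the VC-dimension. -/
lemma shatters_of_localHull_shatters (hk : F.vcDim < k) (hSY : S ⊆ Y)
    (hS : (localHull F k Y).Shatters S) : F.Shatters S := by
  have key {T : Finset α} (hT : T ⊆ S) (hTk : T.card ≤ k) : F.Shatters T := by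
    rw [shatters_iff_forall_exists_agree]
    intro A
    obtain ⟨B, hB, hBA⟩ := shatters_iff_forall_exists_agree.1 (hS.mono_right hT) A
    obtain ⟨C, hC, hCB⟩ := mem_localHull.1 hB T (hT.trans hSY) hTk
    exact ⟨C, hC, fun x hx => (hCB x hx).trans (hBA x hx)⟩
  by_cases hSk : S.card ≤ k
  · exact key Subset.rfl hSk
  · obtain ⟨T, hT, hTk⟩ := exists_subset_card_eq (not_le.1 hSk).le
    have := (key hT hTk.le).card_le_vcDim
    omega

/-- Every subset of `Y` shattered by `F` is the direction set of a cube in the local hull on `Y`. -/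
def HullHasCubes (F : Finset (Finset α)) (k : ℕ) (Y : Finset α) : Prop :=
  ∀ S ⊆ Y, F.Shatters S → StronglyShatters (localHull F k Y) S

lemma HullHasCubes.isSExtremal (h : HullHasCubes F k Y) (hk : F.vcDim < k) :
    IsSExtremal (localHull F k Y) := by
  rw [isSExtremal_iff]
  intro S hS
  obtain ⟨A, hA⟩ := h (S ∩ Y) inter_subset_right
    (shatters_of_localHull_shatters hk inter_subset_right (hS.mono_right inter_subset_left))
  refine ⟨A, fun B hB => ?_⟩
  -- Coordinates outside `Y` are free in the hull, so they are reset to those of `A`.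
  refine mem_localHull_of_agree (H := (A \ S) ∪ (B ∩ S ∩ Y) ∪ ((A ∩ S) \ Y)) ?_ (hA _ ?_)
  · grind
  · grind

/-- The extension exists by counting: the restrictions to `Z` of the hull on `Y` contain a cube for
every set shattered by the hull on `Z`, so they exhaust it. -/
lemma HullHasCubes.exists_agree (h : HullHasCubes F k Y) (hk : F.vcDim < k) (hZ : Z ⊆ Y)
    (hH : H ∈ localHull F k Z) : ∃ C ∈ localHull F k Y, ∀ x ∈ Z, (x ∈ C ↔ x ∈ H) := by
  set Q : Finset (Finset α) :=
    univ.filter fun H => ∃ C ∈ localHull F k Y, ∀ x ∈ Z, (x ∈ C ↔ x ∈ H) with hQ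
  have hmem {B : Finset α} : B ∈ Q ↔ ∃ C ∈ localHull F k Y, ∀ x ∈ Z, (x ∈ C ↔ x ∈ B) := by
    simp [hQ]
  have hsub : Q ⊆ localHull F k Z := by
    intro B hB
    obtain ⟨C, hC, hCB⟩ := hmem.1 hB
    exact mem_localHull_of_agree hCB (localHull_anti hZ hC)
  have hcard : (localHull F k Z).card ≤ Q.card := by
    refine (card_le_card_shatterer _).trans (card_shatterer_le_of_stronglyShatters ?_)
    intro S hS
    obtain ⟨A, hA⟩ := h (S ∩ Z) (inter_subset_right.trans hZ)
      (shatters_of_localHull_shatters hk inter_subset_right (hS.mono_right inter_subset_left))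
    refine ⟨A, fun B hB => hmem.2 ⟨(A \ (S ∩ Z)) ∪ (B ∩ S ∩ Z), hA _ ?_, ?_⟩⟩
    · grind
    · grind
  exact hmem.1 (eq_of_subset_of_card_le hsub hcard ▸ hH)

/-- A cube in a maximal shattered direction set is determined off that set by the local data. -/
lemma agree_of_maximal (hk : F.vcDim < k) {A A' Z' : Finset α} {i : α} (hF : F.Shatters S)
    (hins : ¬ F.Shatters (insert i S)) (hZ : insert i S ⊆ Z) (hZ' : insert i S ⊆ Z')
    (hA : ∀ B : Finset α, (∀ x, x ∉ S → (x ∈ B ↔ x ∈ A)) → B ∈ localHull F k Z)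
    (hA' : ∀ B : Finset α, (∀ x, x ∉ S → (x ∈ B ↔ x ∈ A')) → B ∈ localHull F k Z') :
    i ∈ A ↔ i ∈ A' := by
  by_contra hne
  apply hins
  have hiS : i ∉ S := fun hi => hins (by rwa [insert_eq_of_mem hi])
  -- Size at most `k` lets hull membership be tested on all of `insert i S` at once.
  have hcard : (insert i S).card ≤ k := by
    have := hF.card_le_vcDim
    rw [card_insert_of_notMem hiS]
    omega
  rw [shatters_iff_forall_exists_agree]
  intro D
  by_cases hD : i ∈ D ↔ i ∈ A
  · obtain ⟨B, hB, hBD⟩ := mem_localHull.1 (hA ((A \ S) ∪ (D ∩ S)) (by grind)) _ hZ hcard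
    exact ⟨B, hB, by grind⟩
  · obtain ⟨B, hB, hBD⟩ := mem_localHull.1 (hA' ((A' \ S) ∪ (D ∩ S)) (by grind)) _ hZ' hcard
    exact ⟨B, hB, by grind⟩

lemma hullHasCubes_of_erase (hk : 2 * F.vcDim + 1 ≤ k) (hF : F.vcDim < k) (hY : k < Y.card)
    (ih : ∀ i ∈ Y, HullHasCubes F k (Y.erase i)) : HullHasCubes F k Y := by
  intro S₀ hS₀Y hS₀
  obtain ⟨S, hS₀S, hSmax⟩ := exists_le_maximal (Y.powerset.filter F.Shatters)
    (mem_filter.2 ⟨mem_powerset.2 hS₀Y, hS₀⟩)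
  obtain ⟨hSY, hS⟩ := mem_filter.1 hSmax.prop
  rw [mem_powerset] at hSY
  refine StronglyShatters.mono_right hS₀S ?_
  have hmax : ∀ i ∈ Y \ S, ¬ F.Shatters (insert i S) := by
    intro i hi h
    rw [mem_sdiff] at hi
    exact hi.2 (hSmax.le_of_ge (mem_filter.2
      ⟨mem_powerset.2 (insert_subset hi.1 hSY), h⟩) (subset_insert i S) (mem_insert_self i S))
  have hcardS := hS.card_le_vcDim
  have hcardD := card_sdiff_add_card_eq_card hSY
  have hcube : ∀ j, ∃ A : Finset α, j ∈ Y \ S → ∀ B : Finset α,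
      (∀ x, x ∉ S → (x ∈ B ↔ x ∈ A)) → B ∈ localHull F k (Y.erase j) := by
    intro j
    by_cases hj : j ∈ Y \ S
    · rw [mem_sdiff] at hj
      obtain ⟨A, hA⟩ := ih j hj.1 S (subset_erase.2 ⟨hSY, hj.2⟩) hS
      exact ⟨A, fun _ => hA⟩
    · exact ⟨∅, fun h => absurd h hj⟩
  choose A hA using hcube
  have hagree : ∀ i ∈ Y \ S, ∀ j ∈ Y \ S, ∀ j' ∈ Y \ S, i ≠ j → i ≠ j' →
      (i ∈ A j ↔ i ∈ A j') := by
    intro i hi j hj j' hj' hij hij'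
    exact agree_of_maximal hF hS (hmax i hi) (by grind) (by grind) (hA j hj) (hA j' hj')
  -- The glued base point: `A j` is meaningful only off `j`, and by `hagree` the choice of `j ≠ i`
  -- does not matter.
  refine ⟨univ.filter fun i => ∃ j ∈ Y \ S, i ≠ j ∧ i ∈ A j, fun B hB => ?_⟩
  have hout : ∀ j ∈ Y \ S, B ∈ localHull F k (Y.erase j) := by
    intro j hj
    refine mem_localHull_of_agree (H := (A j \ S) ∪ (B ∩ S)) (fun x hx => ?_)
      (hA j hj _ (by grind))
    by_cases hxS : x ∈ S
    · simp [hxS]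
    · have hx' := mem_erase.1 hx
      rw [hB x hxS]
      simp only [mem_union, mem_sdiff, mem_inter, hxS, mem_filter, mem_univ, true_and,
        not_false_eq_true, and_true, and_false, or_false]
      constructor
      · exact fun h => ⟨j, mem_sdiff.1 hj, hx'.1, h⟩
      · rintro ⟨j', hj', hxj', h⟩
        exact (hagree x (mem_sdiff.2 ⟨hx'.2, hxS⟩) j hj j' (mem_sdiff.2 hj') hx'.1 hxj').2 h
  refine mem_localHull_of_erase hY fun i hi => ?_
  by_cases hiS : i ∈ S
  · by_contra hBi
    have hnbr : ∀ j ∈ Y \ S, symmDiff B {j} ∈ localHull F k (Y.erase i) := by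
      intro j hj
      obtain ⟨C, hC, hCB⟩ := (ih i hi).exists_agree hF (erase_subset j (Y.erase i))
        (localHull_anti (by grind) (hout j hj) : B ∈ localHull F k ((Y.erase i).erase j))
      -- The extension `C` must differ from `B` at `j`, since `B` itself is not in the hull; so it
      -- is the neighbour sought.
      have hj' : ¬ (j ∈ C ↔ j ∈ B) := by
        intro h
        exact hBi (mem_localHull_of_agree (fun x hx => by
          by_cases hxj : x = j
          · rwa [hxj]
          · exact hCB x (mem_erase.2 ⟨hxj, hx⟩)) hC)
      refine mem_localHull_of_agree (fun x hx => ?_) hC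
      by_cases hxj : x = j
      · subst hxj
        simp only [mem_symmDiff, mem_singleton]
        tauto
      · rw [hCB x (mem_erase.2 ⟨hxj, hx⟩)]
        simp [mem_symmDiff, hxj]
    obtain ⟨a, ha⟩ : (Y \ S).Nonempty := by
      rw [← card_pos]
      omega
    have h1 := ((ih i hi).isSExtremal hF).shatters_erase hBi hnbr ha
    have h2 := (shatters_of_localHull_shatters hF (by grind) h1).card_le_vcDim
    rw [card_erase_of_mem ha] at h2
    omega
  · exact hout i (mem_sdiff.2 ⟨hi, hiS⟩)

lemma hullHasCubes_of_card_le (hk : k ≤ Fintype.card α) (hY : Y.card ≤ k)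
    (hproj : ∀ X : Finset α, X.card = k → IsSExtremal (proj F X)) : HullHasCubes F k Y := by
  intro S hSY hS
  obtain ⟨X, hYX, hXk⟩ := exists_superset_card_eq hY hk
  have hSX : (proj F X).Shatters S := by
    rw [shatters_iff_forall_exists_agree] at hS ⊢
    intro A
    obtain ⟨B, hB, hBA⟩ := hS A
    exact ⟨B ∩ X, mem_image_of_mem _ hB, by grind⟩
  refine ((hproj X hXk).stronglyShatters hSX).mono_left fun B hB => mem_localHull.2 ?_
  intro Z hZ _
  obtain ⟨-, C, hC, hCB⟩ := mem_proj_iff.1 hB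
  exact ⟨C, hC, fun x hx => hCB x (hYX (hZ hx))⟩

lemma hullHasCubes (hk : 2 * F.vcDim + 1 ≤ k) (hkα : k ≤ Fintype.card α)
    (hproj : ∀ X : Finset α, X.card = k → IsSExtremal (proj F X)) (Y : Finset α) :
    HullHasCubes F k Y := by
  induction Y using Finset.strongInduction with
  | H Y ih =>
    by_cases hY : Y.card ≤ k
    · exact hullHasCubes_of_card_le hkα hY hproj
    · exact hullHasCubes_of_erase hk (by omega) (not_le.1 hY)
        fun i hi => ih _ (erase_ssubset hi)

end LocalHull

/-- As `k ≤ n`, every test set of size at most `k` extends to one of size exactly `k`. -/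
lemma closureByProj_eq_localHull {n k : ℕ} (hk : k ≤ n) (F : Finset (Finset (Fin n))) :
    closureByProj F k = localHull F k univ := by
  ext H
  simp only [closureByProj, mem_filter, mem_univ, true_and, mem_localHull, mem_proj_iff,
    inter_subset_right, subset_univ, forall_const]
  constructor
  · intro h X hX
    obtain ⟨X', hXX', hX'⟩ := exists_superset_card_eq hX (by simpa using hk)
    obtain ⟨B, hB, hBH⟩ := h X' hX'
    exact ⟨B, hB, by grind⟩
  · intro h X hX
    obtain ⟨B, hB, hBH⟩ := h X hX.le
    exact ⟨B, hB, by grind⟩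

end SExtremal

theorem mainTheorem1 (n t : ℕ) (ht : 1 ≤ t) (hn : 2 * t + 1 ≤ n)
    (F : Finset (Finset (Fin n))) (hF : F.vcDim = t)
    (hproj : ∀ X : Finset (Fin n), X.card = 2 * t + 1 →
      SExtremal.IsSExtremal (SExtremal.proj F X)) :
    F ⊆ SExtremal.closureByProj F (2 * t + 1) ∧
    SExtremal.IsSExtremal (SExtremal.closureByProj F (2 * t + 1)) ∧
    (SExtremal.closureByProj F (2 * t + 1)).vcDim = t ∧
    (SExtremal.IsSExtremal F → SExtremal.closureByProj F (2 * t + 1) = F) := by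
  rw [SExtremal.closureByProj_eq_localHull hn]
  have hlt : F.vcDim < 2 * t + 1 := by omega
  have hsub : F ⊆ SExtremal.localHull F (2 * t + 1) Finset.univ := SExtremal.subset_localHull
  have hext : SExtremal.IsSExtremal (SExtremal.localHull F (2 * t + 1) Finset.univ) :=
    (SExtremal.hullHasCubes (by omega) (by simpa using hn) hproj Finset.univ).isSExtremal hlt
  -- Equal shatterers give the VC-dimension and, if `F` is extremal too, equal cardinalities.
  have hsh : (SExtremal.localHull F (2 * t + 1) Finset.univ).shatterer = F.shatterer := by
    refine Finset.Subset.antisymm (fun S hS => ?_) (Finset.shatterer_mono hsub)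
    rw [Finset.mem_shatterer] at hS ⊢
    exact SExtremal.shatters_of_localHull_shatters hlt (Finset.subset_univ S) hS
  refine ⟨hsub, hext, ?_, fun hFext => ?_⟩
  · rw [Finset.vcDim, hsh, ← Finset.vcDim, hF]
  · refine (Finset.eq_of_subset_of_card_le hsub ?_).symm
    unfold SExtremal.IsSExtremal at hext hFext
    rw [← hext, hsh, hFext]
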